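/- Let $n \ge 1$ and let $\mathcal{C}_{2n}$ be the crown poset, i.e. the poset on $\{1,\dots,2n\}$ with cover relations $1 \prec 2 \succ 3 \prec \cdots \succ 2n-1 \prec 2n \succ 1$. Let $$\mathcal{O}(\mathcal{C}_{2n}) = \{x \in [0,1]^{2n} : x_i \le x_j \text{ whenever } i \preceq j \text{ in } \mathcal{C}_{2n}\}$$ be its order polytope. For a lattice polytope $\mathfrak{p} \subseteq \mathbb{R}^m$ of dimension $d$, the $h^*$-polynomial $h^*(\mathfrak{p},t)$ is the polynomial of degree at most $d$ determined by $$1 + \sum_{k \ge 1} \#(k\mathfrak{p} \cap \mathbb{Z}^m)\, t^k = \frac{h^*(\mathfrak{p},t)}{(1-t)^{d+1}}.$$ Then $$\deg h^*(\mathcal{O}(\mathcal{C}_{2n}),t) = 2n-2.$$ -/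

import Mathlib

open scoped Pointwise Polynomial

/-- The ground set of the crown poset with `2n` elements. The element with index `i : Fin (2 * n)`
is the element usually labelled `i + 1`, so even indices carry the odd labels. -/
def Crown (n : ℕ) : Type := Fin (2 * n)

namespace Crown

instance (n : ℕ) : Fintype (Crown n) := inferInstanceAs (Fintype (Fin (2 * n)))

instance (n : ℕ) : DecidableEq (Crown n) := inferInstanceAs (DecidableEq (Fin (2 * n)))

/-- The zero-based index of an element of the crown. -/
def idx {n : ℕ} (a : Crown n) : ℕ := Fin.val (n := 2 * n) a

theorem idx_lt {n : ℕ} (a : Crown n) : a.idx < 2 * n := Fin.isLt (n := 2 * n) a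

theorem idx_injective {n : ℕ} : Function.Injective (idx : Crown n → ℕ) :=
  fun _ _ h => Fin.ext (n := 2 * n) h

/-- The relations `1 ≺ 2 ≻ 3 ≺ ⋯ ≻ 2n - 1 ≺ 2n ≻ 1`: `a` has an odd label (an even index) and
`b` is its successor or its predecessor in the cyclic order. -/
def Below {n : ℕ} (a b : Crown n) : Prop :=
  a.idx % 2 = 0 ∧ (b.idx = a.idx + 1 ∨ a.idx = (b.idx + 1) % (2 * n))

theorem Below.idx_odd {n : ℕ} {a b : Crown n} (h : Below a b) : b.idx % 2 = 1 := by
  obtain ⟨h0, h1 | h1⟩ := h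
  · omega
  · rcases Nat.lt_or_ge (b.idx + 1) (2 * n) with hb | hb
    · rw [Nat.mod_eq_of_lt hb] at h1
      omega
    · have := b.idx_lt
      omega

/-- The crown poset. -/
instance (n : ℕ) : PartialOrder (Crown n) where
  le a b := a = b ∨ Below a b
  le_refl a := Or.inl rfl
  le_trans a b c hab hbc := by
    rcases hab with rfl | hab
    · exact hbc
    · rcases hbc with rfl | hbc
      · exact Or.inr hab
      · have := hab.idx_odd
        have := hbc.1
        omega
  le_antisymm a b hab hba := by
    rcases hab with h | hab
    · exact h
    · rcases hba with h | hba
      · exact h.symm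
      · have := hab.idx_odd
        have := hba.1
        omega

theorem le_iff {n : ℕ} {a b : Crown n} : a ≤ b ↔ a = b ∨ Below a b := Iff.rfl

theorem lt_iff {n : ℕ} {a b : Crown n} : a < b ↔ Below a b := by
  rw [lt_iff_le_and_ne, le_iff]
  constructor
  · rintro ⟨h | h, hne⟩
    · exact absurd h hne
    · exact h
  · intro h
    refine ⟨Or.inr h, ?_⟩
    rintro rfl
    have := h.idx_odd
    have := h.1
    omega

/-- The cover relations of the crown poset are exactly the relations in `Below`. -/
theorem covBy_iff {n : ℕ} {a b : Crown n} : a ⋖ b ↔ Below a b := by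
  constructor
  · intro h
    exact lt_iff.1 h.lt
  · intro h
    refine ⟨lt_iff.2 h, fun c hac hcb => ?_⟩
    have := (lt_iff.1 hac).idx_odd
    have := (lt_iff.1 hcb).1
    omega

end Crown

/-- The order polytope of a poset `P`, as a subset of `ℝ^P`. -/
def orderPolytope (P : Type*) [PartialOrder P] : Set (P → ℝ) :=
  {x | (∀ i, x i ∈ Set.Icc (0 : ℝ) 1) ∧ ∀ i j, i ≤ j → x i ≤ x j}

/-- The dimension of a subset of `ℝ^ι`: the dimension of its affine hull. -/
noncomputable def polytopeDim {ι : Type*} (S : Set (ι → ℝ)) : ℕ :=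
  Module.finrank ℝ (vectorSpan ℝ S)

/-- The number of integer points of the dilate `k S`. -/
noncomputable def latticePointCount {ι : Type*} (S : Set (ι → ℝ)) (k : ℕ) : ℕ :=
  {z : ι → ℤ | (fun i => (z i : ℝ)) ∈ (k : ℝ) • S}.ncard

/-- The Ehrhart series `1 + ∑_{k ≥ 1} #(k S ∩ ℤ^ι) t^k`. -/
noncomputable def ehrhartSeries {ι : Type*} (S : Set (ι → ℝ)) : PowerSeries ℤ :=
  PowerSeries.mk fun k => if k = 0 then 1 else (latticePointCount S k : ℤ)

/-- `h` is the `h^*`-polynomial of `S`: with `d = dim S`, it has degree at most `d` and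
`1 + ∑_{k ≥ 1} #(k S ∩ ℤ^ι) t^k = h(t) / (1 - t)^(d + 1)`. -/
def IsHStarPolynomial {ι : Type*} (S : Set (ι → ℝ)) (h : ℤ[X]) : Prop :=
  h.natDegree ≤ polytopeDim S ∧
    (1 - PowerSeries.X) ^ (polytopeDim S + 1) * ehrhartSeries S = (h : PowerSeries ℤ)

/-- A set has at most one `h^*`-polynomial. -/
theorem IsHStarPolynomial.unique {ι : Type*} {S : Set (ι → ℝ)} {h h' : ℤ[X]}
    (H : IsHStarPolynomial S h) (H' : IsHStarPolynomial S h') : h = h' :=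
  Polynomial.coe_injective ℤ (H.2.symm.trans H'.2)

/-! Stanley's theory of P-partitions: label the poset so that labels increase with the order.
Sorting values stably, with ties broken by label, assigns each order-preserving map to a chain a
unique linear extension `σ` (`card_monotone_eq_sum`). The maps assigned to `σ` are counted by a
binomial coefficient whose series is `t ^ des σ / (1 - t) ^ (d + 1)`, so `h^*` is the descent
polynomial and its degree is the largest number of descents. Only the decreasing permutation
descends everywhere, and a single relation excludes it (`card_descents_lt`); for the crown this
leaves at most `2n - 2`. Listing the minimal elements in decreasing label order, then the maximal
ones likewise, attains the bound. -/

open Finset in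
/-- The number of positions before `i` that do not belong to `D`. -/
def countBefore {m : ℕ} (D : Finset (Fin m)) (i : Fin (m + 1)) : ℕ :=
  #{j | j ∉ D ∧ j.castSucc < i}

open Finset in
theorem countBefore_le {m : ℕ} (D : Finset (Fin m)) (i : Fin (m + 1)) :
    countBefore D i ≤ m - #D := by
  have h : countBefore D i ≤ #Dᶜ := card_le_card fun j => by simp +contextual
  rwa [card_compl, Fintype.card_fin] at h

open Finset in
theorem countBefore_last {m : ℕ} (D : Finset (Fin m)) :
    countBefore D (Fin.last m) = m - #D := by
  have h : countBefore D (Fin.last m) = #Dᶜ := by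
    refine congrArg card ?_
    ext j
    simp [Fin.castSucc_lt_last]
  rwa [card_compl, Fintype.card_fin] at h

open Finset in
theorem countBefore_succ {m : ℕ} (D : Finset (Fin m)) (i : Fin m) :
    countBefore D i.succ = countBefore D i.castSucc + if i ∈ D then 0 else 1 := by
  unfold countBefore
  split_ifs with hi
  · rw [add_zero]
    refine congrArg card ?_
    ext j
    simp only [mem_filter, mem_univ, true_and, Fin.castSucc_lt_succ_iff, Fin.castSucc_lt_castSucc_iff]
    refine and_congr_right fun hj => ⟨fun h => lt_of_le_of_ne h ?_, le_of_lt⟩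
    rintro rfl
    exact hj hi
  · rw [← card_insert_of_notMem (a := i) (by simp)]
    refine congrArg card ?_
    ext j
    simp only [mem_filter, mem_univ, true_and, mem_insert, Fin.castSucc_lt_succ_iff,
      Fin.castSucc_lt_castSucc_iff]
    rw [le_iff_eq_or_lt]
    constructor
    · tauto
    · rintro (rfl | h)
      · exact ⟨hi, Or.inl rfl⟩
      · tauto

/-- A sequence is compatible with `D` if it is weakly increasing, and strictly so at the positions
in `D`. -/
def IsCompatible {m : ℕ} {α : Type*} [Preorder α] (D : Finset (Fin m)) (a : Fin (m + 1) → α) :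
    Prop :=
  ∀ i : Fin m, a i.castSucc ≤ a i.succ ∧ (i ∈ D → a i.castSucc < a i.succ)

theorem IsCompatible.monotone {m : ℕ} {α : Type*} [Preorder α] {D : Finset (Fin m)}
    {a : Fin (m + 1) → α} (h : IsCompatible D a) : Monotone a :=
  Fin.monotone_iff_le_succ.2 fun i => (h i).1

theorem le_of_strictMono_countBefore {m N : ℕ} (D : Finset (Fin m)) {b : Fin (m + 1) → Fin N}
    (hb : StrictMono b) (i : Fin (m + 1)) : countBefore D i ≤ b i := by
  induction i using Fin.induction with
  | zero => simp [countBefore]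
  | succ i ih =>
    have h : (b i.castSucc : ℕ) < b i.succ := hb Fin.castSucc_lt_succ
    rw [countBefore_succ]
    split_ifs <;> omega

theorem isCompatible_sub_countBefore {m N : ℕ} (D : Finset (Fin m)) {b : Fin (m + 1) → Fin N}
    (hb : StrictMono b) : IsCompatible D fun i => (b i : ℕ) - countBefore D i := by
  intro i
  have h : (b i.castSucc : ℕ) < b i.succ := hb Fin.castSucc_lt_succ
  have h1 := le_of_strictMono_countBefore D hb i.castSucc
  have h2 := countBefore_succ D i
  by_cases hi : i ∈ D <;> simp only [hi, if_true, if_false, true_imp_iff, false_imp_iff] at h2 ⊢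
  · omega
  · exact ⟨by omega, trivial⟩

open Finset in
/-- Adding `countBefore D` turns compatible sequences into strictly increasing ones. -/
def compatibleEquiv {m : ℕ} (D : Finset (Fin m)) (k : ℕ) :
    {a : Fin (m + 1) → Fin (k + 1) // IsCompatible D a} ≃
      (Fin (m + 1) ↪o Fin (k + 1 + m - #D)) where
  toFun a := OrderEmbedding.ofStrictMono
    (fun i => ⟨a.1 i + countBefore D i, by
      have h1 := countBefore_le D i
      have h2 : #D ≤ m := by simpa using card_le_univ D
      have h3 := (a.1 i).isLt
      omega⟩) (by
      refine Fin.strictMono_iff_lt_succ.2 fun i => ?_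
      obtain ⟨h1, h2⟩ := a.2 i
      have h3 := countBefore_succ D i
      rw [Fin.le_def] at h1
      rw [Fin.lt_def] at h2
      rw [Fin.mk_lt_mk]
      split_ifs at h3 with hi
      · have := h2 hi
        omega
      · omega)
  invFun b := ⟨fun i => ⟨b i - countBefore D i, by
      -- By monotonicity only the last entry needs a bound, and there the shift is exactly `m - #D`.
      have h1 := (isCompatible_sub_countBefore D b.strictMono).monotone (Fin.le_last i)
      have h2 := (b (Fin.last m)).isLt
      have h3 : #D ≤ m := by simpa using card_le_univ D
      have h4 := countBefore_last D
      omega⟩, fun i => isCompatible_sub_countBefore D b.strictMono i⟩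
  left_inv a := by
    ext i
    simp
  right_inv b := by
    ext i
    simp [Nat.sub_add_cancel (le_of_strictMono_countBefore D b.strictMono i)]

open Finset in
theorem card_isCompatible {m : ℕ} (D : Finset (Fin m)) (k : ℕ) :
    Nat.card {a : Fin (m + 1) → Fin (k + 1) // IsCompatible D a} =
      (k + 1 + m - #D).choose (m + 1) := by
  rw [Nat.card_congr (compatibleEquiv D k), Nat.card_congr Set.powersetCard.ofFinEmbEquiv,
    Set.powersetCard.card, Nat.card_fin]

/-! ### Descents and linear extensions -/

/-- The positions of the descents of a permutation. -/
def descents {m : ℕ} (σ : Equiv.Perm (Fin (m + 1))) : Finset (Fin m) :=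
  {i | σ i.succ < σ i.castSucc}

/-- The stable sort makes the pairs (value, label) lexicographically increasing, so equal neighbours
are allowed exactly where `σ` ascends. -/
theorem sort_eq_iff_isCompatible {m : ℕ} {α : Type*} [LinearOrder α] (g : Fin (m + 1) → α)
    (σ : Equiv.Perm (Fin (m + 1))) :
    σ = Tuple.sort g ↔ IsCompatible (descents σ) (g ∘ σ) := by
  have h : σ = Tuple.sort g ↔ StrictMono fun i => toLex (g (σ i), σ i) := Tuple.eq_sort_iff'
  rw [h, Fin.strictMono_iff_lt_succ]
  refine forall_congr' fun i => ?_
  have hne : σ i.castSucc ≠ σ i.succ := fun h => Fin.castSucc_lt_succ.ne (σ.injective h)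
  simp only [Prod.Lex.toLex_lt_toLex, descents, Finset.mem_filter, Finset.mem_univ, true_and,
    Function.comp_apply]
  rcases lt_trichotomy (g (σ i.castSucc)) (g (σ i.succ)) with h | h | h
  · simp [h, h.le]
  · simp only [h, lt_irrefl, true_and, false_or, le_refl, imp_false, not_lt]
    exact ⟨le_of_lt, fun h => lt_of_le_of_ne h hne⟩
  · simp [h.not_gt, h.ne', h.not_ge]

section LinearExtensions

variable {P : Type*} [PartialOrder P] {m : ℕ}

open Classical in
/-- The linear extensions of a poset `P` labelled by `e`, as permutations of the labels: the label
of the element in position `i` is `σ i`. -/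
noncomputable def linearExtensions (e : P ≃ Fin (m + 1)) : Finset (Equiv.Perm (Fin (m + 1))) :=
  {σ | StrictMono fun a => σ.symm (e a)}

theorem mem_linearExtensions {e : P ≃ Fin (m + 1)} {σ : Equiv.Perm (Fin (m + 1))} :
    σ ∈ linearExtensions e ↔ StrictMono fun a => σ.symm (e a) := by
  simp [linearExtensions]

theorem monotone_iff_sort_mem_linearExtensions {α : Type*} [LinearOrder α] {e : P ≃ Fin (m + 1)}
    (he : StrictMono e) (f : P → α) :
    Monotone f ↔ Tuple.sort (f ∘ e.symm) ∈ linearExtensions e := by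
  rw [mem_linearExtensions]
  obtain ⟨h1, h2⟩ := Tuple.eq_sort_iff.1 (rfl : Tuple.sort (f ∘ e.symm) = _)
  generalize Tuple.sort (f ∘ e.symm) = σ at h1 h2
  constructor
  · intro hf a b hab
    by_contra hle
    have hlt : σ.symm (e b) < σ.symm (e a) := by
      refine lt_of_le_of_ne (not_lt.1 hle) fun h => hab.ne' ?_
      exact e.injective (σ.symm.injective h)
    have h3 := h1 hlt.le
    have h4 := h2 _ _ hlt
    simp only [Function.comp_apply, Equiv.apply_symm_apply, Equiv.symm_apply_apply] at h3 h4
    -- If `b` is placed before `a < b`, the two values tie, and the tie-break contradicts the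
    -- natural labelling.
    exact (he hab).not_gt (h4 (le_antisymm h3 (hf hab.le)))
  · intro hσ a b hab
    have h3 := h1 (hσ.monotone hab)
    simpa using h3

open Finset in
theorem card_monotone_eq_sum [Finite P] {e : P ≃ Fin (m + 1)} (he : StrictMono e) (k : ℕ) :
    Nat.card {f : P → Fin (k + 1) // Monotone f} =
      ∑ σ ∈ linearExtensions e, (k + 1 + m - #(descents σ)).choose (m + 1) := by
  classical
  have := Fintype.ofFinite P
  rw [Nat.card_eq_fintype_card, Fintype.card_subtype,
    card_eq_sum_card_fiberwise (f := fun f => Tuple.sort (f ∘ e.symm)) (t := linearExtensions e)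
      fun f hf => (monotone_iff_sort_mem_linearExtensions he f).1 (by simpa using hf)]
  refine sum_congr rfl fun σ hσ => ?_
  rw [← card_isCompatible, Nat.card_eq_fintype_card, Fintype.card_subtype]
  -- Reading the values of `f` in the order given by `σ` turns the fibre over `σ` into compatible
  -- sequences.
  refine card_equiv (Equiv.arrowCongr (e.trans σ.symm) (Equiv.refl _)) fun f => ?_
  have hc : (Equiv.arrowCongr (e.trans σ.symm) (Equiv.refl _)) f = (f ∘ e.symm) ∘ σ := by
    ext i
    simp
  rw [hc]
  simp only [mem_filter, mem_univ, true_and]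
  rw [← sort_eq_iff_isCompatible, monotone_iff_sort_mem_linearExtensions he]
  exact ⟨fun h => h.2.symm, fun h => ⟨h ▸ hσ, h.symm⟩⟩

open Finset in
/-- The descent generating polynomial of the linear extensions of a labelled poset. -/
noncomputable def descentPolynomial (e : P ≃ Fin (m + 1)) : ℤ[X] :=
  ∑ σ ∈ linearExtensions e, Polynomial.X ^ #(descents σ)

end LinearExtensions

open PowerSeries in
theorem one_sub_X_pow_mul_mk_choose (m s : ℕ) (hs : s ≤ m) :
    (1 - X) ^ (m + 2) * PowerSeries.mk (fun k => ((k + 1 + m - s).choose (m + 1) : ℤ)) = X ^ s := by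
  have h : PowerSeries.mk (fun k => ((k + 1 + m - s).choose (m + 1) : ℤ)) =
      X ^ s * PowerSeries.mk fun k => ((m + 1 + k).choose (m + 1) : ℤ) := by
    ext k
    rw [coeff_X_pow_mul', coeff_mk]
    split_ifs with hk
    · rw [coeff_mk]
      congr 2
      omega
    · rw [Nat.choose_eq_zero_of_lt (by omega), Nat.cast_zero]
  rw [h, mul_left_comm, mul_comm ((1 - X) ^ (m + 2)), mk_add_choose_mul_one_sub_pow_eq_one, mul_one]

/-! ### Ehrhart series of order polytopes -/

section OrderPolytope

variable {P : Type*} [PartialOrder P]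

open Classical in
theorem indicator_mem_orderPolytope {U : Set P} (hU : IsUpperSet U) :
    U.indicator (1 : P → ℝ) ∈ orderPolytope P := by
  refine ⟨fun i => ?_, fun i j hij => ?_⟩
  · by_cases h : i ∈ U <;> simp [h]
  · by_cases h : i ∈ U
    · simp [h, hU hij h]
    · by_cases h' : j ∈ U <;> simp [h, h']

theorem vectorSpan_orderPolytope [Finite P] : vectorSpan ℝ (orderPolytope P) = ⊤ := by
  classical
  have key : ∀ {U : Set P}, IsUpperSet U →
      U.indicator (1 : P → ℝ) ∈ vectorSpan ℝ (orderPolytope P) := by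
    intro U hU
    have h := vsub_mem_vectorSpan ℝ (indicator_mem_orderPolytope hU)
      (indicator_mem_orderPolytope (isUpperSet_empty (α := P)))
    rwa [Set.indicator_empty, vsub_eq_sub, show (fun _ : P => (0 : ℝ)) = 0 from rfl, sub_zero] at h
  rw [eq_top_iff, ← (Pi.basisFun ℝ P).span_eq, Submodule.span_le]
  rintro _ ⟨a, rfl⟩
  -- The indicators of the up-sets `Ici a` and `Ioi a` differ by the basis vector at `a`.
  have h := sub_mem (key (isUpperSet_Ici a)) (key (isUpperSet_Ioi a))
  refine (congrArg (· ∈ vectorSpan ℝ (orderPolytope P)) (funext fun b => ?_)).mpr h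
  rcases eq_or_ne b a with rfl | hb
  · simp
  · by_cases hab : a ≤ b
    · simp [hb, hab, lt_of_le_of_ne hab hb.symm]
    · simp [hb, hab, mt le_of_lt hab]

theorem polytopeDim_orderPolytope [Fintype P] :
    polytopeDim (orderPolytope P) = Fintype.card P := by
  rw [polytopeDim, vectorSpan_orderPolytope, finrank_top, Module.finrank_fintype_fun_eq_card]

theorem mem_smul_orderPolytope_iff {k : ℕ} (hk : k ≠ 0) (z : P → ℤ) :
    (fun i => (z i : ℝ)) ∈ (k : ℝ) • orderPolytope P ↔
      (∀ i, z i ∈ Set.Icc 0 (k : ℤ)) ∧ Monotone z := by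
  have hk' : (0 : ℝ) < k := by exact_mod_cast Nat.pos_of_ne_zero hk
  rw [Set.mem_smul_set_iff_inv_smul_mem₀ hk'.ne']
  simp only [orderPolytope, Set.mem_ofPred_eq, Pi.smul_apply, smul_eq_mul, Set.mem_Icc,
    inv_mul_le_iff₀ hk', mul_one, mul_inv_cancel_left₀ hk'.ne', Monotone]
  refine and_congr (forall_congr' fun i => and_congr ?_ ?_) (forall₃_congr fun i j h => ?_)
  · rw [mul_nonneg_iff_of_pos_left (inv_pos.2 hk')]
    exact_mod_cast Iff.rfl
  · exact_mod_cast Iff.rfl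
  · exact_mod_cast Iff.rfl

/-- The lattice points of a dilate of the order polytope are the order-preserving maps to a
chain. -/
def latticePointEquiv (P : Type*) [PartialOrder P] (k : ℕ) :
    {z : P → ℤ // (∀ i, z i ∈ Set.Icc 0 (k : ℤ)) ∧ Monotone z} ≃
      {f : P → Fin (k + 1) // Monotone f} where
  toFun z := ⟨fun i => ⟨(z.1 i).toNat, by have := (z.2.1 i).2; omega⟩, fun i j hij =>
    Int.toNat_le_toNat (z.2.2 hij)⟩
  invFun f := ⟨fun i => (f.1 i : ℕ), fun i => ⟨Int.natCast_nonneg _,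
    Int.ofNat_le.2 (Nat.lt_succ_iff.1 (f.1 i).isLt)⟩, fun _ _ hij => Int.ofNat_le.2 (f.2 hij)⟩
  left_inv z := by
    ext i
    simpa using (z.2.1 i).1
  right_inv f := by
    ext i
    simp

theorem latticePointCount_orderPolytope {k : ℕ} (hk : k ≠ 0) :
    latticePointCount (orderPolytope P) k = Nat.card {f : P → Fin (k + 1) // Monotone f} := by
  rw [latticePointCount, ← Nat.card_congr (latticePointEquiv P k), ← Nat.card_coe_set_eq]
  exact Nat.card_congr (Equiv.subtypeEquivRight fun z => mem_smul_orderPolytope_iff hk z)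

theorem ehrhartSeries_orderPolytope :
    ehrhartSeries (orderPolytope P) =
      PowerSeries.mk fun k => (Nat.card {f : P → Fin (k + 1) // Monotone f} : ℤ) := by
  refine congrArg PowerSeries.mk (funext fun k => ?_)
  split_ifs with hk
  · subst hk
    have : Unique {f : P → Fin (0 + 1) // Monotone f} :=
      ⟨⟨⟨0, fun _ _ _ => le_rfl⟩⟩, fun f => Subtype.ext (funext fun i => Subsingleton.elim (α := Fin 1) _ _)⟩
    rw [Nat.card_unique, Nat.cast_one]
  · rw [latticePointCount_orderPolytope hk]

open Finset in
theorem card_descents_le {m : ℕ} (σ : Equiv.Perm (Fin (m + 1))) : #(descents σ) ≤ m := by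
  simpa using card_le_univ (descents σ)

open Finset in
/-- The `h^*`-polynomial of an order polytope counts linear extensions by descents. -/
theorem isHStarPolynomial_descentPolynomial [Fintype P] {m : ℕ} {e : P ≃ Fin (m + 1)}
    (he : StrictMono e) : IsHStarPolynomial (orderPolytope P) (descentPolynomial e) := by
  have hcard : Fintype.card P = m + 1 := by simpa using Fintype.card_congr e
  rw [IsHStarPolynomial, polytopeDim_orderPolytope, hcard]
  constructor
  · refine Polynomial.natDegree_sum_le_of_forall_le _ _ fun σ _ => ?_
    rw [Polynomial.natDegree_X_pow]
    exact (card_descents_le σ).trans m.le_succ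
  · have h : ehrhartSeries (orderPolytope P) = ∑ σ ∈ linearExtensions e,
        PowerSeries.mk fun k => ((k + 1 + m - #(descents σ)).choose (m + 1) : ℤ) := by
      rw [ehrhartSeries_orderPolytope]
      ext k
      simp [card_monotone_eq_sum he]
    rw [h, mul_sum, descentPolynomial, ← Polynomial.coeToPowerSeries.ringHom_apply, map_sum]
    refine sum_congr rfl fun σ _ => ?_
    rw [one_sub_X_pow_mul_mk_choose _ _ (card_descents_le σ)]
    simp

end OrderPolytope

/-! ### Degree of the descent polynomial -/

open Finset in
theorem card_descents_lt {P : Type*} [PartialOrder P] {m : ℕ} {e : P ≃ Fin (m + 1)}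
    (he : StrictMono e) {a b : P} (hab : a < b) {σ : Equiv.Perm (Fin (m + 1))}
    (hσ : σ ∈ linearExtensions e) : #(descents σ) < m := by
  refine lt_of_le_of_ne (card_descents_le σ) fun h => ?_
  have h1 : descents σ = univ := (card_eq_iff_eq_univ _).1 (by simpa using h)
  have h2 : StrictAnti σ := Fin.strictAnti_iff_succ_lt.2 fun i => by
    have hi : i ∈ descents σ := h1 ▸ mem_univ i
    simpa [descents] using hi
  have h3 := h2 (mem_linearExtensions.1 hσ hab)
  simp only [Equiv.apply_symm_apply] at h3
  exact (he hab).not_gt h3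

open Finset in
theorem degree_descentPolynomial {P : Type*} [PartialOrder P] {m N : ℕ} {e : P ≃ Fin (m + 1)}
    (hle : ∀ σ ∈ linearExtensions e, #(descents σ) ≤ N)
    (heq : ∃ σ ∈ linearExtensions e, #(descents σ) = N) :
    (descentPolynomial e).degree = N := by
  refine Polynomial.degree_eq_of_le_of_coeff_ne_zero ?_ ?_
  · refine Polynomial.degree_le_of_natDegree_le
      (Polynomial.natDegree_sum_le_of_forall_le _ _ fun σ hσ => ?_)
    rw [Polynomial.natDegree_X_pow]
    exact hle σ hσ
  · obtain ⟨σ, hσ, hN⟩ := heq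
    simp only [descentPolynomial, Polynomial.finsetSum_coeff, Polynomial.coeff_X_pow]
    -- All contributions are nonnegative, so nothing cancels the term of `σ`.
    refine (sum_pos' (fun τ _ => by split_ifs <;> simp) ⟨σ, hσ, ?_⟩).ne'
    simp [hN]

/-! ### The crown: an extremal linear extension -/

namespace Crown

variable {n m : ℕ}

/-- The natural labelling of the crown that lists the minimal elements before the maximal ones. -/
def labelling (h : 2 * n = m + 1) : Crown n ≃ Fin (m + 1) where
  toFun a := ⟨if a.idx % 2 = 0 then a.idx / 2 else n + a.idx / 2, by
    have := a.idx_lt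
    split_ifs <;> omega⟩
  invFun i := (⟨if (i : ℕ) < n then 2 * i else 2 * (i - n) + 1, by
    have := i.isLt
    split_ifs <;> omega⟩ : Fin (2 * n))
  left_inv a := by
    refine idx_injective ?_
    have := a.idx_lt
    change (if (if a.idx % 2 = 0 then a.idx / 2 else n + a.idx / 2) < n then
      2 * (if a.idx % 2 = 0 then a.idx / 2 else n + a.idx / 2) else
      2 * ((if a.idx % 2 = 0 then a.idx / 2 else n + a.idx / 2) - n) + 1) = a.idx
    split_ifs <;> omega
  right_inv i := by
    have := i.isLt
    simp only [idx, Fin.ext_iff]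
    split_ifs <;> omega

theorem labelling_val (h : 2 * n = m + 1) (a : Crown n) :
    (labelling h a : ℕ) = if a.idx % 2 = 0 then a.idx / 2 else n + a.idx / 2 := rfl

theorem labelling_lt_le (h : 2 * n = m + 1) {a b : Crown n} (hab : a < b) :
    (labelling h a : ℕ) < n ∧ n ≤ (labelling h b : ℕ) := by
  have h1 := (lt_iff.1 hab).idx_odd
  have h2 := (lt_iff.1 hab).1
  have h3 := a.idx_lt
  rw [labelling_val, labelling_val, if_pos h2, if_neg (by omega)]
  omega

theorem labelling_strictMono (h : 2 * n = m + 1) : StrictMono (labelling h) := fun _ _ hab =>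
  Fin.lt_def.2 ((labelling_lt_le h hab).1.trans_le (labelling_lt_le h hab).2)

/-- The permutation that reverses the first half and the second half of the labels. -/
def reverseHalves (h : 2 * n = m + 1) : Equiv.Perm (Fin (m + 1)) :=
  Function.Involutive.toPerm
    (fun i => ⟨if (i : ℕ) < n then n - 1 - i else 3 * n - 1 - i, by
      have := i.isLt
      split_ifs <;> omega⟩) fun i => by
      have := i.isLt
      simp only [Fin.ext_iff]
      split_ifs <;> omega

theorem reverseHalves_val (h : 2 * n = m + 1) (i : Fin (m + 1)) :
    (reverseHalves h i : ℕ) = if (i : ℕ) < n then n - 1 - i else 3 * n - 1 - i := rfl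

theorem reverseHalves_mem_linearExtensions (h : 2 * n = m + 1) :
    reverseHalves h ∈ linearExtensions (labelling h) := by
  refine mem_linearExtensions.2 fun a b hab => ?_
  obtain ⟨h1, h2⟩ := labelling_lt_le h hab
  have h3 := (labelling h b).isLt
  -- The permutation is its own inverse by construction.
  change reverseHalves h (labelling h a) < reverseHalves h (labelling h b)
  rw [Fin.lt_def, reverseHalves_val, reverseHalves_val, if_pos h1, if_neg h2.not_gt]
  omega

open Finset in
theorem card_descents_reverseHalves (h : 2 * n = m + 1) :
    #(descents (reverseHalves h)) = m - 1 := by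
  -- The only ascent is at the junction of the halves, where the value jumps from `0` to `2n - 1`.
  have h1 : descents (reverseHalves h) = univ.erase ⟨n - 1, by omega⟩ := by
    ext i
    have := i.isLt
    simp only [descents, mem_filter, mem_univ, true_and, mem_erase, and_true, Fin.lt_def,
      reverseHalves_val, Fin.val_succ, Fin.val_castSucc, ne_eq, Fin.ext_iff]
    split_ifs <;> omega
  rw [h1, card_erase_of_mem (mem_univ _), card_univ, Fintype.card_fin]

end Crown

theorem mainTheorem10 (n : ℕ) (hn : 1 ≤ n) :
    ∃ h : ℤ[X], IsHStarPolynomial (orderPolytope (Crown n)) h ∧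
      h.degree = ((2 * n - 2 : ℕ) : WithBot ℕ) := by
  obtain ⟨m, hm⟩ : ∃ m, 2 * n = m + 1 := ⟨2 * n - 1, by omega⟩
  have hmn : 2 * n - 2 = m - 1 := by omega
  rw [hmn]
  refine ⟨descentPolynomial (Crown.labelling hm),
    isHStarPolynomial_descentPolynomial (Crown.labelling_strictMono hm),
    degree_descentPolynomial (fun σ hσ => ?_)
      ⟨_, Crown.reverseHalves_mem_linearExtensions hm, Crown.card_descents_reverseHalves hm⟩⟩
  let a : Crown n := (⟨0, by omega⟩ : Fin (2 * n))
  let b : Crown n := (⟨1, by omega⟩ : Fin (2 * n))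
  have hab : a < b := Crown.lt_iff.2 ⟨rfl, Or.inl rfl⟩
  exact Nat.le_sub_one_of_lt (card_descents_lt (Crown.labelling_strictMono hm) hab hσ)
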